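/- Let $V$ be a finite set, let $B\in\mathbb{R}^{V\times V}$ satisfy $\det(I-B)\neq 0$, let $\varepsilon=(\varepsilon_v)_{v\in V}$ be mutually independent real random variables on a probability space, and let $X=(X_v)_{v\in V}$ be the (almost surely unique) solution of the linear cyclic structural causal model $X=BX+\varepsilon$, i.e. $X=(I-B)^{-1}\varepsilon$ almost surely. Let $G$ be the directed graph on $V$ with an edge $u\to v$ whenever $B_{vu}\neq 0$; $G$ may contain cycles. Let $G^{\mathrm{sc}}$ be its condensation: the vertices of $G^{\mathrm{sc}}$ are the strongly connected components (the classes of mutual reachability) of $G$, and there is an edge $\pi\to\pi'$ whenever $\pi\neq\pi'$ and $G$ has an edge $u\to v$ with $u\in\pi$, $v\in\pi'$. For each component $\pi$ let $X_\pi=(X_v)_{v\in\pi}$ be the corresponding vector-valued cluster variable. Then $G^{\mathrm{sc}}$ is acyclic, and the joint distribution of the cluster variables $(X_\pi)_\pi$ is Markov with respect to $G^{\mathrm{sc}}$: for all pairwise disjoint sets $S,T,Z$ of components such that $Z$ d-separates $S$ from $T$ in $G^{\mathrm{sc}}$, the families $(X_\pi)_{\pi\in S}$ and $(X_\pi)_{\pi\in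 T}$ are conditionally independent given $(X_\pi)_{\pi\in Z}$. Here $Z$ d-separates $S$ from $T$ if no walk from a vertex of $S$ to a vertex of $T$ (edges may be traversed in either direction) is open given $Z$; a walk is open given $Z$ if its end points are not in $Z$, each interior vertex at which two arrowheads of the walk meet (a collider) is in $Z$ or has a descendant in $Z$, and no other interior vertex is in $Z$. -/

import Mathlib

open MeasureTheory ProbabilityTheory

noncomputable section

namespace CyclicSCM

section Graph

variable {V W : Type*}

/-- `u ⇝ v`: there is a directed path, possibly of length `0`, from `u` to `v`. -/
def Reaches (G : Digraph V) (u v : V) : Prop := Relation.ReflTransGen G.Adj u v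

/-- No directed cycle (of positive length; self-loops count as cycles). -/
def IsAcyclic (G : Digraph V) : Prop := ∀ v, ¬ Relation.TransGen G.Adj v v

/-- Mutual reachability; its classes are the strongly connected components. -/
def sccSetoid (G : Digraph V) : Setoid V where
  r u v := Reaches G u v ∧ Reaches G v u
  iseqv :=
    { refl := fun _ => ⟨.refl, .refl⟩
      symm := fun h => ⟨h.2, h.1⟩
      trans := fun h k => ⟨h.1.trans k.1, k.2.trans h.2⟩ }

/-- The set of strongly connected components of `G`. -/
abbrev SCC (G : Digraph V) : Type _ := Quotient (sccSetoid G)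

/-- The component containing a given vertex. -/
def scc (G : Digraph V) (v : V) : SCC G := Quotient.mk (sccSetoid G) v

/-- The vertices belonging to the component `c`. -/
abbrev Cluster (G : Digraph V) (c : SCC G) : Type _ := {v : V // scc G v = c}

/-- The quotient of `G` along `χ`: an edge `χ u → χ v` for every edge `u → v` with `χ u ≠ χ v`. -/
def quotientGraph (G : Digraph V) (χ : V → W) : Digraph W where
  Adj c d := ∃ u v, G.Adj u v ∧ χ u ≠ χ v ∧ χ u = c ∧ χ v = d

/-- The condensation of `G`: the quotient by the partition into strongly connected components. -/
def condensation (G : Digraph V) : Digraph (SCC G) := quotientGraph G (scc G)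

/-- A walk `node 0, …, node len` in the skeleton of `G`, each step carrying the orientation of the
edge it traverses: `node k → node (k + 1)` if `fwd k`, and `node k ← node (k + 1)` otherwise.
The values of `node` beyond `len`, and of `fwd` from `len` on, are irrelevant. -/
structure Walk (G : Digraph V) where
  /-- number of edges -/
  len : ℕ
  /-- vertices -/
  node : ℕ → V
  /-- orientations -/
  fwd : ℕ → Prop
  adj_fwd : ∀ k < len, fwd k → G.Adj (node k) (node (k + 1))
  adj_bwd : ∀ k < len, ¬ fwd k → G.Adj (node (k + 1)) (node k)

/-- The interior vertex `node (k + 1)` is a collider: `node k → node (k + 1) ← node (k + 2)`. -/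
def Walk.IsCollider {G : Digraph V} (p : Walk G) (k : ℕ) : Prop := p.fwd k ∧ ¬ p.fwd (k + 1)

/-- `p` is open given `C`: its end points are not in `C`, each of its colliders is in `C` or has a
descendant in `C`, and none of its interior non-colliders is in `C`. -/
def Walk.IsOpen {G : Digraph V} (p : Walk G) (C : Set V) : Prop :=
  p.node 0 ∉ C ∧ p.node p.len ∉ C ∧
    ∀ k, k + 1 < p.len →
      (p.IsCollider k → ∃ c ∈ C, Reaches G (p.node (k + 1)) c) ∧
      (¬ p.IsCollider k → p.node (k + 1) ∉ C)

/-- `A` and `B` are d-separated by `C`: no walk from `A` to `B` is open given `C`. -/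
def DSep (G : Digraph V) (A B C : Set V) : Prop :=
  ∀ p : Walk G, p.node 0 ∈ A → p.node p.len ∈ B → ¬ p.IsOpen C

end Graph

section Markov

variable {ι : Type*}

/-- The coordinates with index in `A`. -/
def proj (𝓧 : ι → Type*) (A : Set ι) (x : ∀ i, 𝓧 i) : ∀ i : A, 𝓧 i := fun i => x i

theorem measurable_proj {𝓧 : ι → Type*} [∀ i, MeasurableSpace (𝓧 i)] (A : Set ι) :
    Measurable (proj 𝓧 A) :=
  measurable_pi_lambda _ fun i => measurable_pi_apply (i : ι)

/-- The (global, directed) Markov property of a joint distribution `P` of variables indexed by the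
vertices of `G`: whenever `C` d-separates `A` from `B`, the variables in `A` and those in `B` are
conditionally independent given those in `C`. -/
def IsMarkov [Countable ι] {𝓧 : ι → Type*} [∀ i, MeasurableSpace (𝓧 i)]
    [∀ i, StandardBorelSpace (𝓧 i)] (G : Digraph ι) (P : Measure (∀ i, 𝓧 i)) [IsFiniteMeasure P] : Prop :=
  ∀ A B C : Set ι, Disjoint A B → Disjoint A C → Disjoint B C → DSep G A B C →
    CondIndepFun (MeasurableSpace.comap (proj 𝓧 C) inferInstance)
      (measurable_proj C).comap_le (proj 𝓧 A) (proj 𝓧 B) P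

end Markov

section SCM

variable {V Ω : Type*}

/-- The directed graph of a weighted adjacency matrix: `u → v` if and only if `B v u ≠ 0`. -/
def graph (B : Matrix V V ℝ) : Digraph V where
  Adj u v := B v u ≠ 0

/-- The linear cyclic structural causal model `X = B X + ε` with mutually independent noise
variables `ε v` and `det (I - B) ≠ 0`. -/
structure IsLinearSCM [Fintype V] [DecidableEq V] [MeasurableSpace Ω] (μ : Measure Ω)
    (B : Matrix V V ℝ) (ε X : V → Ω → ℝ) : Prop where
  measurable_noise : ∀ v, Measurable (ε v)
  indep_noise : iIndepFun ε μ
  det_ne_zero : (1 - B).det ≠ 0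
  structural_eq : ∀ᵐ ω ∂μ, ∀ v, X v ω = ∑ w, B v w * X w ω + ε v ω

/-- The joint distribution of the cluster variables `X_c = (X v)_{v ∈ c}`, where `c` runs over the
strongly connected components of `G`. -/
def clusterLaw [MeasurableSpace Ω] (μ : Measure Ω) (G : Digraph V) (X : V → Ω → ℝ) :
    Measure (∀ c : SCC G, Cluster G c → ℝ) :=
  μ.map fun ω _ v => X v ω

instance [MeasurableSpace Ω] (μ : Measure Ω) [IsFiniteMeasure μ] (G : Digraph V)
    (X : V → Ω → ℝ) : IsFiniteMeasure (clusterLaw μ G X) :=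
  inferInstanceAs (IsFiniteMeasure (μ.map _))

end SCM

end CyclicSCM

end

/-!
The diagonal blocks of `1 - B` along the strongly connected components are invertible, so each
cluster variable is a function of the noise in its component and of the cluster variables at the
parents of the component: the condensation carries a recursive, acyclic structural system, and the
Markov property is a property of such systems.

If `C` d-separates `A` from `B`, the ancestors of `A ∪ B ∪ C` split into a part `N₁` around `A` and
a part `N₂` around `B` such that an edge from one part to the other starts in `C`. Reveal the
variables of `C` in a topological order. Each of them is a function of what has been revealed before
and of the noise of one of the two parts, so the noises of the two parts, independent at the start,
stay conditionally independent, just as the private inputs of the two parties to a communication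
protocol do given the transcript. In the end, the variables of each part are functions of its noise
and of the variables of `C`.
-/

namespace CyclicSCM

open MeasureTheory ProbabilityTheory

section CondIndep

variable {Ω : Type*} {m' m₁ m₂ m₃ mΩ : MeasurableSpace Ω} {μ : Measure Ω}

theorem isPiSystem_image2_inter (m₁ m₂ : MeasurableSpace Ω) :
    IsPiSystem (Set.image2 (· ∩ ·) {s | MeasurableSet[m₁] s} {t | MeasurableSet[m₂] t}) := by
  rintro _ ⟨s, hs, t, ht, rfl⟩ _ ⟨s', hs', t', ht', rfl⟩ -
  exact ⟨s ∩ s', hs.inter hs', t ∩ t', ht.inter ht', Set.inter_inter_inter_comm _ _ _ _⟩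

theorem sup_eq_generateFrom_image2_inter (m₁ m₂ : MeasurableSpace Ω) :
    m₁ ⊔ m₂ = MeasurableSpace.generateFrom
      (Set.image2 (· ∩ ·) {s | MeasurableSet[m₁] s} {t | MeasurableSet[m₂] t}) := by
  refine le_antisymm (sup_le (fun s hs => ?_) (fun t ht => ?_)) (MeasurableSpace.generateFrom_le ?_)
  · exact MeasurableSpace.measurableSet_generateFrom
      ⟨s, hs, Set.univ, MeasurableSet.univ, Set.inter_univ s⟩
  · exact MeasurableSpace.measurableSet_generateFrom
      ⟨Set.univ, MeasurableSet.univ, t, ht, Set.univ_inter t⟩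
  · rintro _ ⟨s, hs, t, ht, rfl⟩
    exact ((le_sup_left : m₁ ≤ m₁ ⊔ m₂) s hs).inter ((le_sup_right : m₂ ≤ m₁ ⊔ m₂) t ht)

theorem setIntegral_eq_of_generateFrom {E : Type*} [NormedAddCommGroup E] [NormedSpace ℝ E]
    {f g : Ω → E} {m : MeasurableSpace Ω} (hm : m ≤ mΩ) {S : Set (Set Ω)}
    (hS : m = MeasurableSpace.generateFrom S) (hpi : IsPiSystem S) (huniv : Set.univ ∈ S)
    (hf : Integrable f μ) (hg : Integrable g μ)
    (h : ∀ s ∈ S, ∫ x in s, f x ∂μ = ∫ x in s, g x ∂μ) {s : Set Ω} (hs : MeasurableSet[m] s) :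
    ∫ x in s, f x ∂μ = ∫ x in s, g x ∂μ := by
  have hval : ∀ {f : Ω → E}, Integrable f μ → ∀ t, MeasurableSet[m] t →
      (μ.withDensityᵥ f).trim hm t = ∫ x in t, f x ∂μ := fun hf t ht => by
    rw [VectorMeasure.trim_measurableSet_eq hm ht, withDensityᵥ_apply hf (hm t ht)]
  have hS_meas : ∀ t ∈ S, MeasurableSet[m] t :=
    fun t ht => hS ▸ MeasurableSpace.measurableSet_generateFrom ht
  have heq : ∀ t ∈ S, (μ.withDensityᵥ f).trim hm t = (μ.withDensityᵥ g).trim hm t :=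
    fun t ht => by rw [hval hf t (hS_meas t ht), hval hg t (hS_meas t ht), h t ht]
  rw [← hval hf s hs, ← hval hg s hs,
    VectorMeasure.ext_of_generateFrom S heq hS hpi (heq _ huniv)]

variable [IsFiniteMeasure μ]

theorem condExp_indicator_mul_condExp {s t : Set Ω} (hs : MeasurableSet s) :
    μ[s.indicator (μ⟦t | m'⟧) | m'] =ᵐ[μ] (μ⟦s | m'⟧) * (μ⟦t | m'⟧) := by
  have hmul : s.indicator (fun _ => (1 : ℝ)) * μ⟦t | m'⟧ = s.indicator (μ⟦t | m'⟧) := by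
    ext ω
    by_cases hω : ω ∈ s <;> simp [hω]
  rw [← hmul]
  refine condExp_mul_of_stronglyMeasurable_right stronglyMeasurable_condExp ?_
    ((integrable_const _).indicator hs)
  rw [hmul]
  exact integrable_condExp.indicator hs

variable [StandardBorelSpace Ω]

theorem condExp_sup_ae_eq_of_condIndep {hm' : m' ≤ mΩ} (hm₁ : m₁ ≤ mΩ) (hm₂ : m₂ ≤ mΩ)
    (h : CondIndep m' m₁ m₂ hm' μ) {t : Set Ω} (ht : MeasurableSet[m₂] t) :
    μ⟦t | m' ⊔ m₁⟧ =ᵐ[μ] μ⟦t | m'⟧ := by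
  rw [condIndep_iff _ _ _ hm' hm₁ hm₂] at h
  have hsup : m' ⊔ m₁ ≤ mΩ := sup_le hm' hm₁
  have hint : Integrable (t.indicator fun _ => (1 : ℝ)) μ :=
    (integrable_const _).indicator (hm₂ _ ht)
  have hsm : StronglyMeasurable[m' ⊔ m₁] (μ⟦t | m'⟧) := stronglyMeasurable_condExp.mono le_sup_left
  refine (ae_eq_condExp_of_forall_setIntegral_eq hsup hint
    (fun _ _ _ => integrable_condExp.integrableOn) (fun s hs _ => ?_)
    hsm.aestronglyMeasurable).symm
  refine setIntegral_eq_of_generateFrom hsup (sup_eq_generateFrom_image2_inter m' m₁)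
    (isPiSystem_image2_inter m' m₁)
    ⟨Set.univ, MeasurableSet.univ, Set.univ, MeasurableSet.univ, Set.inter_univ _⟩
    integrable_condExp hint ?_ hs
  rintro _ ⟨c, hc, a, ha, rfl⟩
  have hcond : μ[a.indicator (μ⟦t | m'⟧) | m'] =ᵐ[μ]
      μ[a.indicator (t.indicator fun _ => (1 : ℝ)) | m'] :=
    (condExp_indicator_mul_condExp (hm₁ _ ha)).trans
      (by rw [Set.indicator_indicator]; exact (h a t ha ht).symm)
  rw [← setIntegral_indicator (hm₁ _ ha), ← setIntegral_indicator (hm₁ _ ha),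
    ← setIntegral_condExp hm' (integrable_condExp.indicator (hm₁ _ ha)) hc,
    ← setIntegral_condExp hm' (hint.indicator (hm₁ _ ha)) hc]
  exact integral_congr_ae (ae_restrict_of_ae hcond)

theorem condIndep_of_condExp_sup_ae_eq (hm' : m' ≤ mΩ) (hm₁ : m₁ ≤ mΩ) (hm₂ : m₂ ≤ mΩ)
    (h : ∀ t, MeasurableSet[m₂] t → μ⟦t | m' ⊔ m₁⟧ =ᵐ[μ] μ⟦t | m'⟧) : CondIndep m' m₁ m₂ hm' μ := by
  refine (condIndep_iff _ _ _ hm' hm₁ hm₂ μ).2 fun a t ha ht => ?_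
  have hint : Integrable (t.indicator fun _ => (1 : ℝ)) μ :=
    (integrable_const _).indicator (hm₂ _ ht)
  have ha' : MeasurableSet[m' ⊔ m₁] a := (le_sup_right : m₁ ≤ m' ⊔ m₁) _ ha
  calc μ⟦a ∩ t | m'⟧ =ᵐ[μ] μ[μ⟦a ∩ t | m' ⊔ m₁⟧ | m'] :=
        (condExp_condExp_of_le le_sup_left (sup_le hm' hm₁)).symm
    _ =ᵐ[μ] μ[a.indicator (μ⟦t | m' ⊔ m₁⟧) | m'] := by
        rw [← Set.indicator_indicator]
        exact condExp_congr_ae (condExp_indicator hint ha')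
    _ =ᵐ[μ] μ[a.indicator (μ⟦t | m'⟧) | m'] := condExp_congr_ae ((h t ht).indicator)
    _ =ᵐ[μ] (μ⟦a | m'⟧) * (μ⟦t | m'⟧) := condExp_indicator_mul_condExp (hm₁ _ ha)

theorem condIndep_sup_self_right {hm' : m' ≤ mΩ} (hm₁ : m₁ ≤ mΩ) (hm₂ : m₂ ≤ mΩ)
    (h : CondIndep m' m₁ m₂ hm' μ) : CondIndep m' m₁ (m₂ ⊔ m') hm' μ := by
  refine (condIndep_of_condExp_sup_ae_eq hm' (sup_le hm₂ hm') hm₁ fun t ht => ?_).symm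
  rw [sup_comm m₂ m', ← sup_assoc, sup_idem]
  exact condExp_sup_ae_eq_of_condIndep hm₂ hm₁ h.symm ht

theorem condIndep_of_le_of_le_sup {hm' : m' ≤ mΩ} (hm₁ : m₁ ≤ mΩ) (hm₂ : m₂ ≤ mΩ)
    (hm₃ : m₃ ≤ mΩ) (h : CondIndep m' m₁ m₂ hm' μ) (hle : m' ≤ m₃) (hle_sup : m₃ ≤ m₁ ⊔ m') :
    CondIndep m₃ m₁ m₂ hm₃ μ := by
  have h₁ : ∀ {t}, MeasurableSet[m₂] t → μ⟦t | m' ⊔ m₁⟧ =ᵐ[μ] μ⟦t | m'⟧ :=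
    condExp_sup_ae_eq_of_condIndep hm₁ hm₂ h
  rw [sup_comm] at hle_sup
  have hsup : m₃ ⊔ m₁ = m' ⊔ m₁ :=
    le_antisymm (sup_le hle_sup le_sup_right) (sup_le_sup_right hle _)
  refine condIndep_of_condExp_sup_ae_eq hm₃ hm₁ hm₂ fun t ht => ?_
  have hsm : StronglyMeasurable[m₃] (μ⟦t | m'⟧) := stronglyMeasurable_condExp.mono hle
  rw [hsup]
  calc μ⟦t | m' ⊔ m₁⟧ =ᵐ[μ] μ⟦t | m'⟧ := h₁ ht
    _ = μ[μ⟦t | m'⟧ | m₃] := (condExp_of_stronglyMeasurable hm₃ hsm integrable_condExp).symm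
    _ =ᵐ[μ] μ[μ⟦t | m' ⊔ m₁⟧ | m₃] := condExp_congr_ae (h₁ ht).symm
    _ =ᵐ[μ] μ⟦t | m₃⟧ := condExp_condExp_of_le hle_sup (sup_le hm' hm₁)

theorem condIndep_of_indep_of_le {hm' : m' ≤ mΩ} (hm₁ : m₁ ≤ mΩ) (hm₂ : m₂ ≤ mΩ)
    (h : Indep m₁ m₂ μ) (hle : m' ≤ m₁) : CondIndep m' m₁ m₂ hm' μ := by
  refine condIndep_of_condExp_sup_ae_eq hm' hm₁ hm₂ fun t ht => ?_
  have ht' : StronglyMeasurable[m₂] (t.indicator fun _ => (1 : ℝ)) :=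
    stronglyMeasurable_const.indicator ht
  rw [sup_eq_right.2 hle]
  exact (condExp_indep_eq hm₂ hm₁ ht' h.symm).trans
    (condExp_indep_eq hm₂ hm' ht' (indep_of_indep_of_le_left h hle).symm).symm

end CondIndep

section DSep

variable {V : Type*} {G : Digraph V} {A B C : Set V}

/-- The ancestors of `S`: the vertices from which `S` can be reached, those of `S` included. -/
def ancestors (G : Digraph V) (S : Set V) : Set V := {v | ∃ s ∈ S, Reaches G v s}

theorem subset_ancestors (G : Digraph V) (S : Set V) : S ⊆ ancestors G S :=
  fun s hs => ⟨s, hs, .refl⟩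

theorem mem_ancestors_of_adj {S : Set V} {u v : V} (h : G.Adj u v) (hv : v ∈ ancestors G S) :
    u ∈ ancestors G S :=
  let ⟨s, hs, hvs⟩ := hv
  ⟨s, hs, hvs.head h⟩

namespace Walk

/-- The condition of `Walk.IsOpen` on the interior vertices. A walk can be prolonged past an end
point that violates the condition on end points, as long as that vertex becomes a collider. -/
def IsOpenInside (p : Walk G) (C : Set V) : Prop :=
  ∀ k, k + 1 < p.len →
    (p.IsCollider k → p.node (k + 1) ∈ ancestors G C) ∧ (¬ p.IsCollider k → p.node (k + 1) ∉ C)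

/-- The last edge of `p` points to its last vertex; false for a walk without edges. -/
def HeadAtEnd (p : Walk G) : Prop := ∃ k, k + 1 = p.len ∧ p.fwd k

/-- The walk `p` prolonged by one edge. -/
def snoc (p : Walk G) (w : V) (b : Prop) (hf : b → G.Adj (p.node p.len) w)
    (hb : ¬ b → G.Adj w (p.node p.len)) : Walk G where
  len := p.len + 1
  node := Function.update p.node (p.len + 1) w
  fwd := Function.update p.fwd p.len b
  adj_fwd k hk h := by
    rcases Nat.lt_succ_iff_lt_or_eq.1 hk with hk | rfl
    · rw [Function.update_of_ne hk.ne] at h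
      rw [Function.update_of_ne (Nat.lt_succ_of_lt hk).ne,
        Function.update_of_ne (Nat.succ_lt_succ hk).ne]
      exact p.adj_fwd k hk h
    · simpa using hf (by simpa using h)
  adj_bwd k hk h := by
    rcases Nat.lt_succ_iff_lt_or_eq.1 hk with hk | rfl
    · rw [Function.update_of_ne hk.ne] at h
      rw [Function.update_of_ne (Nat.lt_succ_of_lt hk).ne,
        Function.update_of_ne (Nat.succ_lt_succ hk).ne]
      exact p.adj_bwd k hk h
    · simpa using hb (by simpa using h)

variable {p : Walk G} {w : V} {b : Prop} {hf : b → G.Adj (p.node p.len) w}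
  {hb : ¬ b → G.Adj w (p.node p.len)}

theorem headAtEnd_snoc : (p.snoc w b hf hb).HeadAtEnd ↔ b := by
  simp [HeadAtEnd, snoc]

theorem IsOpenInside.snoc (hp : p.IsOpenInside C)
    (hc : p.HeadAtEnd ∧ ¬ b → p.node p.len ∈ ancestors G C)
    (hnc : ¬ (p.HeadAtEnd ∧ ¬ b) → p.node p.len ∉ C) : (p.snoc w b hf hb).IsOpenInside C := by
  intro k hk
  have hnode : (p.snoc w b hf hb).node (k + 1) = p.node (k + 1) :=
    Function.update_of_ne hk.ne _ _
  have hfwd : (p.snoc w b hf hb).fwd k = p.fwd k :=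
    Function.update_of_ne (Nat.lt_of_succ_lt_succ hk).ne _ _
  rcases (Nat.le_of_lt_succ hk).lt_or_eq with hlt | hlast
  · have hfwd' : (p.snoc w b hf hb).fwd (k + 1) = p.fwd (k + 1) :=
      Function.update_of_ne hlt.ne _ _
    simpa only [IsCollider, hnode, hfwd, hfwd'] using hp k hlt
  · have hfwd' : (p.snoc w b hf hb).fwd (k + 1) = b := hlast ▸ Function.update_self _ _ _
    have hhead : p.HeadAtEnd ↔ p.fwd k :=
      ⟨fun ⟨j, hj, h⟩ => Nat.succ_injective (hj.trans hlast.symm) ▸ h, fun h => ⟨k, hlast, h⟩⟩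
    rw [IsCollider, hnode, hfwd, hfwd', ← hhead, hlast]
    exact ⟨hc, hnc⟩

end Walk

/-- There is a walk from `A` to `v` that is open given `C`, except that `v` itself may be in `C`;
`d` tells whether this walk has an arrowhead at `v`. -/
def OpenConn (G : Digraph V) (A C : Set V) (v : V) (d : Prop) : Prop :=
  ∃ p : Walk G, p.node 0 ∈ A \ C ∧ p.node p.len = v ∧ (p.HeadAtEnd ↔ d) ∧ p.IsOpenInside C

namespace OpenConn

variable {u v w : V} {d : Prop}

theorem of_mem (hv : v ∈ A) (hvC : v ∉ C) : OpenConn G A C v False :=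
  ⟨⟨0, fun _ => v, fun _ => False, by simp, by simp⟩, ⟨hv, hvC⟩, rfl,
    by simp [Walk.HeadAtEnd], by simp [Walk.IsOpenInside]⟩

theorem fwd (h : OpenConn G A C u d) (huC : u ∉ C) (huw : G.Adj u w) : OpenConn G A C w True := by
  obtain ⟨p, h0, rfl, -, hp⟩ := h
  exact ⟨p.snoc w True (fun _ => huw) (by simp), by simpa [Walk.snoc] using h0, by simp [Walk.snoc],
    Walk.headAtEnd_snoc, hp.snoc (by simp) (fun _ => huC)⟩

theorem bwd (h : OpenConn G A C u d) (hd : d → u ∈ ancestors G C) (hnd : ¬ d → u ∉ C)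
    (hwu : G.Adj w u) : OpenConn G A C w False := by
  obtain ⟨p, h0, rfl, hpd, hp⟩ := h
  exact ⟨p.snoc w False (by simp) (fun _ => hwu), by simpa [Walk.snoc] using h0,
    by simp [Walk.snoc], Walk.headAtEnd_snoc,
    hp.snoc (by simpa [hpd] using hd) (by simpa [hpd] using hnd)⟩

theorem of_reaches (h : OpenConn G A C u d) (huv : Reaches G u v) (hu : u ∉ ancestors G C) :
    ∃ d', OpenConn G A C v d' := by
  induction huv using Relation.ReflTransGen.head_induction_on generalizing d with
  | refl => exact ⟨d, h⟩
  | head hux _ ih =>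
    exact ih (h.fwd (fun hC => hu (subset_ancestors G C hC)) hux)
      (fun hx => hu (mem_ancestors_of_adj hux hx))

theorem of_reaches_source (hv : v ∈ A) (huv : Reaches G u v) (hu : u ∉ ancestors G C) :
    OpenConn G A C u False := by
  induction huv using Relation.ReflTransGen.head_induction_on with
  | refl => exact of_mem hv (fun hC => hu (subset_ancestors G C hC))
  | head hux _ ih =>
    have hx := fun hx => hu (mem_ancestors_of_adj hux hx)
    exact (ih hx).bwd False.elim (fun _ hC => hx (subset_ancestors G C hC)) hux

end OpenConn

theorem DSep.not_openConn (h : DSep G A B C) {v : V} {d : Prop} (hv : v ∈ B) (hvC : v ∉ C) :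
    ¬ OpenConn G A C v d := by
  rintro ⟨p, ⟨h0A, h0C⟩, rfl, -, hp⟩
  exact h p h0A hv ⟨h0C, hvC, hp⟩

theorem DSep.openConn_parent (h : DSep G A B C) {u v : V} {d : Prop}
    (hv : OpenConn G A C v d) (hvC : v ∈ C → d) (hvD : v ∈ ancestors G (A ∪ B ∪ C))
    (huv : G.Adj u v) : OpenConn G A C u False := by
  by_cases hC : v ∈ ancestors G C
  · exact hv.bwd (fun _ => hC) (mt hvC) huv
  have hnC : v ∉ C := fun hvC => hC (subset_ancestors G C hvC)
  obtain ⟨x, (hxA | hxB) | hxC, hvx⟩ := hvD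
  · exact (OpenConn.of_reaches_source hxA hvx hC).bwd False.elim (fun _ => hnC) huv
  · have hxC : x ∉ C := fun hxC => hC ⟨x, hxC, hvx⟩
    obtain ⟨d', hx⟩ := hv.of_reaches hvx hC
    exact (h.not_openConn hxB hxC hx).elim
  · exact (hC ⟨x, hxC, hvx⟩).elim

/-- `C` separates `N₁` from `N₂` at the level of noise: each side is closed under taking parents,
up to vertices of `C`, and each vertex of `C` belongs to one of the sides. -/
structure IsNoiseSplit (G : Digraph V) (C N₁ N₂ : Set V) : Prop where
  disjoint : Disjoint N₁ N₂
  subset_union : C ⊆ N₁ ∪ N₂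
  parent_left : ∀ v ∈ N₁, ∀ u, G.Adj u v → u ∈ N₁ ∪ C
  parent_right : ∀ v ∈ N₂, ∀ u, G.Adj u v → u ∈ N₂ ∪ C

theorem DSep.exists_isNoiseSplit (h : DSep G A B C) :
    ∃ N₁ N₂, IsNoiseSplit G C N₁ N₂ ∧ A ⊆ N₁ ∪ C ∧ B ⊆ N₂ ∪ C := by
  set D := ancestors G (A ∪ B ∪ C)
  have hsub : A ∪ B ∪ C ⊆ D := subset_ancestors G _
  -- A vertex of `C` goes to the side of `A` if an open walk from `A` points at it: only then can
  -- the walk be continued to its parents.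
  let N : Set V := {v ∈ D | ∃ d, OpenConn G A C v d ∧ (v ∈ C → d)}
  have hchild : ∀ {u v}, u ∈ N → u ∉ C → G.Adj u v → v ∈ D → v ∈ N :=
    fun ⟨_, _, hu, _⟩ huC huv hvD => ⟨hvD, True, hu.fwd huC huv, fun _ => trivial⟩
  refine ⟨N, D \ N, ⟨Set.disjoint_sdiff_right, ?_, ?_, ?_⟩, ?_, ?_⟩
  · exact fun c hc => or_iff_not_imp_left.2 fun hcN => ⟨hsub (.inr hc), hcN⟩
  · rintro v ⟨hvD, d, hv, hvC⟩ u huv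
    exact or_iff_not_imp_right.2 fun huC => ⟨mem_ancestors_of_adj huv hvD, False,
      h.openConn_parent hv hvC hvD huv, fun hC => huC hC⟩
  · rintro v ⟨hvD, hvN⟩ u huv
    exact or_iff_not_imp_right.2 fun huC =>
      ⟨mem_ancestors_of_adj huv hvD, fun huN => hvN (hchild huN huC huv hvD)⟩
  · exact fun a ha => or_iff_not_imp_right.2 fun haC =>
      ⟨hsub (.inl (.inl ha)), False, .of_mem ha haC, fun hC => haC hC⟩
  · exact fun b hb => or_iff_not_imp_right.2 fun hbC =>
      ⟨hsub (.inl (.inr hb)), fun ⟨_, _, hconn, _⟩ => h.not_openConn hb hbC hconn⟩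

end DSep

section Structural

variable {ι Ω : Type*} {mΩ : MeasurableSpace Ω} {μ : Measure Ω} {G : Digraph ι}
  {m n : ι → MeasurableSpace Ω} {C E N N₁ N₂ : Set ι} {v : ι}

theorem IsAcyclic.wellFounded [Finite ι] (hG : IsAcyclic G) : WellFounded G.Adj := by
  have : Std.Irrefl (Relation.TransGen G.Adj) := ⟨hG⟩
  exact Subrelation.wf (fun h => Relation.TransGen.single h)
    (Finite.wellFounded_of_trans_of_irrefl (Relation.TransGen G.Adj))

theorem IsAcyclic.induction_on_univ [Finite ι] (hG : IsAcyclic G) {P : Set ι → Prop}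
    (empty : P ∅)
    (insert : ∀ E v, (∀ w ∈ insert v E, ∀ u, G.Adj u w → u ∈ E) → P E → P (insert v E)) :
    P Set.univ := by
  obtain ⟨E, ⟨hE, hPE⟩, hmax⟩ :=
    (Set.toFinite {E | (∀ w ∈ E, ∀ u, G.Adj u w → u ∈ E) ∧ P E}).exists_maximal
      ⟨∅, fun _ hw => (Set.notMem_empty _ hw).elim, empty⟩
  suffices hEc : Eᶜ = ∅ by rwa [Set.compl_empty_iff.1 hEc] at hPE
  by_contra hne
  obtain ⟨v, hvE, hv⟩ := hG.wellFounded.has_min Eᶜ (Set.nonempty_iff_ne_empty.2 hne)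
  have hpa : ∀ w ∈ Insert.insert v E, ∀ u, G.Adj u w → u ∈ E := by
    rintro w (rfl | hw) u huw
    exacts [not_not.1 fun huE => hv u huE huw, hE w hw u huw]
  exact hvE (hmax ⟨fun w hw u huw => .inr (hpa w hw u huw), insert E v hpa hPE⟩
    (Set.subset_insert v E) (Set.mem_insert v E))

/-- A recursive structural system over `G`, in terms of σ-algebras: the variable at `i`, which
generates `m i`, is a function of a noise variable, which generates `n i`, and of the variables at
the parents of `i`. -/
structure IsRecursiveSystem (G : Digraph ι) (m n : ι → MeasurableSpace Ω)
    {mΩ : MeasurableSpace Ω} (μ : Measure Ω) : Prop where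
  isAcyclic : IsAcyclic G
  noise_le : ∀ i, n i ≤ mΩ
  indep_noise : ∀ S T : Set ι, Disjoint S T → Indep (⨆ i ∈ S, n i) (⨆ i ∈ T, n i) μ
  le_noise_sup : ∀ i, m i ≤ n i ⊔ ⨆ j ∈ {j | G.Adj j i}, m j

namespace IsRecursiveSystem

theorem iSup_noise_le (h : IsRecursiveSystem G m n μ) (S : Set ι) : ⨆ i ∈ S, n i ≤ mΩ :=
  iSup₂_le fun i _ => h.noise_le i

variable [Finite ι]

theorem iSup_le_noise_sup (h : IsRecursiveSystem G m n μ)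
    (hN : ∀ v ∈ N, ∀ u, G.Adj u v → u ∈ N ∪ C) :
    ⨆ i ∈ N, m i ≤ (⨆ i ∈ N, n i) ⊔ ⨆ i ∈ C, m i := by
  refine iSup₂_le fun v hv => ?_
  induction v using h.isAcyclic.wellFounded.induction with
  | _ v ih =>
    refine (h.le_noise_sup v).trans
      (sup_le (le_sup_of_le_left (le_iSup₂_of_le v hv le_rfl)) (iSup₂_le fun u huv => ?_))
    rcases hN v hv u huv with huN | huC
    · exact ih u huv huN
    · exact le_sup_of_le_right (le_iSup₂_of_le u huC le_rfl)

protected theorem iSup_le (h : IsRecursiveSystem G m n μ) (S : Set ι) : ⨆ i ∈ S, m i ≤ mΩ := by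
  have huniv := h.iSup_le_noise_sup (N := Set.univ) (C := ∅) (by simp)
  rw [iSup_emptyset, sup_bot_eq] at huniv
  exact (biSup_mono (Set.subset_univ S)).trans (huniv.trans (h.iSup_noise_le _))

variable [StandardBorelSpace Ω] [IsFiniteMeasure μ]

theorem condIndep_noise_insert (h : IsRecursiveSystem G m n μ)
    (hN : ∀ v ∈ N₁, ∀ u, G.Adj u v → u ∈ N₁ ∪ C)
    (hE : ∀ w ∈ insert v E, ∀ u, G.Adj u w → u ∈ E) (hv : v ∈ N₁) (hvC : v ∈ C)
    (hind : CondIndep (⨆ i ∈ C ∩ E, m i) (⨆ i ∈ N₁, n i) (⨆ i ∈ N₂, n i) (h.iSup_le _) μ) :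
    CondIndep (⨆ i ∈ C ∩ insert v E, m i) (⨆ i ∈ N₁, n i) (⨆ i ∈ N₂, n i) (h.iSup_le _) μ := by
  have hpa : ∀ w ∈ N₁ ∩ insert v E, ∀ u, G.Adj u w → u ∈ N₁ ∩ insert v E ∪ C ∩ E :=
    fun w hw u huw => (hN w hw.1 u huw).imp (fun huN => ⟨huN, .inr (hE w hw.2 u huw)⟩)
      (fun huC => ⟨huC, hE w hw.2 u huw⟩)
  have hmv : m v ≤ (⨆ i ∈ N₁, n i) ⊔ ⨆ i ∈ C ∩ E, m i :=
    calc m v ≤ ⨆ i ∈ N₁ ∩ insert v E, m i :=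
          le_iSup₂_of_le v ⟨hv, Set.mem_insert v E⟩ le_rfl
      _ ≤ (⨆ i ∈ N₁ ∩ insert v E, n i) ⊔ ⨆ i ∈ C ∩ E, m i := h.iSup_le_noise_sup hpa
      _ ≤ (⨆ i ∈ N₁, n i) ⊔ ⨆ i ∈ C ∩ E, m i :=
          sup_le_sup_right (biSup_mono Set.inter_subset_left) _
  refine condIndep_of_le_of_le_sup (h.iSup_noise_le _) (h.iSup_noise_le _) _ hind
    (biSup_mono (Set.inter_subset_inter_right C (Set.subset_insert v E))) ?_
  rw [Set.inter_insert_of_mem hvC, iSup_insert]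
  exact sup_le hmv le_sup_right

theorem condIndep_noise (h : IsRecursiveSystem G m n μ) (hN : IsNoiseSplit G C N₁ N₂) :
    CondIndep (⨆ i ∈ C, m i) (⨆ i ∈ N₁, n i) (⨆ i ∈ N₂, n i) (h.iSup_le _) μ := by
  suffices hE : CondIndep (⨆ i ∈ C ∩ Set.univ, m i) (⨆ i ∈ N₁, n i) (⨆ i ∈ N₂, n i)
      (h.iSup_le _) μ by
    simpa only [Set.inter_univ] using hE
  refine h.isAcyclic.induction_on_univ (P := fun E =>
    CondIndep (⨆ i ∈ C ∩ E, m i) (⨆ i ∈ N₁, n i) (⨆ i ∈ N₂, n i) (h.iSup_le _) μ) ?_ ?_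
  · exact condIndep_of_indep_of_le (h.iSup_noise_le _) (h.iSup_noise_le _)
      (h.indep_noise _ _ hN.disjoint) (by simp)
  · intro E v hE hind
    by_cases hvC : v ∈ C
    · rcases hN.subset_union hvC with hv | hv
      · exact h.condIndep_noise_insert hN.parent_left hE hv hvC hind
      · exact (h.condIndep_noise_insert hN.parent_right hE hv hvC hind.symm).symm
    · simpa only [Set.inter_insert_of_notMem hvC] using hind

theorem condIndep (h : IsRecursiveSystem G m n μ) (hN : IsNoiseSplit G C N₁ N₂) :
    CondIndep (⨆ i ∈ C, m i) (⨆ i ∈ N₁ ∪ C, m i) (⨆ i ∈ N₂ ∪ C, m i) (h.iSup_le _) μ := by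
  have hle : ∀ {N}, (∀ v ∈ N, ∀ u, G.Adj u v → u ∈ N ∪ C) →
      ⨆ i ∈ N ∪ C, m i ≤ (⨆ i ∈ N, n i) ⊔ ⨆ i ∈ C, m i := fun hN => by
    rw [iSup_union]
    exact sup_le (h.iSup_le_noise_sup hN) le_sup_right
  have h₂ := condIndep_of_condIndep_of_le_right (condIndep_sup_self_right (h.iSup_noise_le _)
    (h.iSup_noise_le _) (h.condIndep_noise hN)) (hle hN.parent_right)
  exact (condIndep_of_condIndep_of_le_right (condIndep_sup_self_right (h.iSup_le _)
    (h.iSup_noise_le _) h₂.symm) (hle hN.parent_left)).symm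

theorem condIndep_of_dSep (h : IsRecursiveSystem G m n μ) {A B : Set ι} (hsep : DSep G A B C) :
    CondIndep (⨆ i ∈ C, m i) (⨆ i ∈ A, m i) (⨆ i ∈ B, m i) (h.iSup_le _) μ := by
  obtain ⟨N₁, N₂, hN, hA, hB⟩ := hsep.exists_isNoiseSplit
  exact condIndep_of_condIndep_of_le_left
    (condIndep_of_condIndep_of_le_right (h.condIndep hN) (biSup_mono hB)) (biSup_mono hA)

end IsRecursiveSystem

end Structural

section Condensation

variable {V : Type*} {G : Digraph V}

theorem reaches_of_reaches_condensation {c d : SCC G} (h : Reaches (condensation G) c d)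
    {u v : V} (hu : scc G u = c) (hv : scc G v = d) : Reaches G u v := by
  induction h generalizing v with
  | refl => exact (Quotient.exact (hu.trans hv.symm)).1
  | tail _ hbc ih =>
    obtain ⟨x, y, hxy, -, rfl, rfl⟩ := hbc
    exact ((ih rfl).tail hxy).trans (Quotient.exact hv.symm).1

theorem isAcyclic_condensation (G : Digraph V) : IsAcyclic (condensation G) := by
  intro c hc
  obtain ⟨d, ⟨u, v, huv, hne, rfl, rfl⟩, hdc⟩ := Relation.TransGen.head'_iff.1 hc
  exact hne (Quotient.sound ⟨.single huv, reaches_of_reaches_condensation hdc rfl rfl⟩)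

theorem IsAcyclic.reaches_antisymm (hG : IsAcyclic G) {u v : V} (huv : Reaches G u v)
    (hvu : Reaches G v u) : u = v := by
  rcases Relation.reflTransGen_iff_eq_or_transGen.1 huv with h | h
  · exact h.symm
  · exact (hG u (h.trans_left hvu)).elim

end Condensation

section Blocks

variable {V α R : Type*} [Fintype V] [DecidableEq α] [CommRing R] {M : Matrix V V R} {b : V → α}
  {c : α}

theorem isUnit_det_toSquareBlock [DecidableEq V] [Finite α] [PartialOrder α]
    (hM : ∀ i j, M i j ≠ 0 → b i ≤ b j) (hdet : IsUnit M.det) (c : α) :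
    IsUnit (M.toSquareBlock b c).det := by
  have : Fintype (LinearExtension α) := Fintype.ofFinite α
  let _ : DecidableEq (LinearExtension α) := inferInstanceAs (DecidableEq α)
  have htri : M.BlockTriangular (fun v => toLinearExtension (b v)) := by
    intro i j hij
    by_contra h
    exact absurd (toLinearExtension.monotone (hM i j h)) (not_le.2 hij)
  rw [htri.det_fintype, IsUnit.prod_iff] at hdet
  exact hdet (toLinearExtension c) (Finset.mem_univ _)

theorem toSquareBlock_mulVec (M : Matrix V V R) (b : V → α) (c : α) (x : V → R) :
    (M.toSquareBlock b c).mulVec (fun v => x v) = fun v : {v // b v = c} =>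
      M.mulVec x v - ∑ u : {u // b u ≠ c}, M v u * x u := by
  ext v
  exact eq_sub_of_add_eq
    (Fintype.sum_subtype_add_sum_subtype (fun u => b u = c) fun u => M v u * x u)

theorem eq_inv_toSquareBlock_mulVec [DecidableEq V] (hc : IsUnit (M.toSquareBlock b c).det)
    (x : V → R) :
    (fun v : {v // b v = c} => x v) = (M.toSquareBlock b c)⁻¹.mulVec fun v =>
      M.mulVec x v - ∑ u : {u // b u ≠ c}, M v u * x u := by
  rw [← toSquareBlock_mulVec, Matrix.mulVec_mulVec, Matrix.nonsing_inv_mul _ hc, Matrix.one_mulVec]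

variable [MeasurableSpace R] [MeasurableAdd₂ R] [MeasurableSub₂ R] [MeasurableMul R]

theorem measurable_of_measurable_mulVec [DecidableEq V] {E : Type*} {_ : MeasurableSpace E}
    {x : E → V → R} (hc : IsUnit (M.toSquareBlock b c).det)
    (hMx : ∀ v, b v = c → Measurable fun e => M.mulVec (x e) v)
    (hx : ∀ v u, b v = c → b u ≠ c → M v u ≠ 0 → Measurable fun e => x e u)
    {v : V} (hv : b v = c) : Measurable fun e => x e v := by
  have hsolve : (fun e => x e v) = fun e => ((M.toSquareBlock b c)⁻¹.mulVec fun w =>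
      M.mulVec (x e) w - ∑ u : {u // b u ≠ c}, M w u * x e u) ⟨v, hv⟩ :=
    funext fun e => congrFun (eq_inv_toSquareBlock_mulVec hc (x e)) ⟨v, hv⟩
  rw [hsolve]
  refine Finset.measurable_fun_sum _ fun w _ => Measurable.const_mul
    ((hMx w w.2).sub (Finset.measurable_fun_sum _ fun u _ => ?_)) _
  by_cases hMwu : M w u = 0
  · simpa only [hMwu, zero_mul] using measurable_const
  · exact (hx w u w.2 u.2 hMwu).const_mul _

end Blocks

section Independence

theorem indep_iSup_fiber {ι κ Ω : Type*} {mΩ : MeasurableSpace Ω} {μ : Measure Ω}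
    {m : ι → MeasurableSpace Ω} (hm : ∀ i, m i ≤ mΩ) (h : iIndep m μ) (f : ι → κ) {S T : Set κ}
    (hST : Disjoint S T) :
    Indep (⨆ c ∈ S, ⨆ i ∈ {i | f i = c}, m i) (⨆ c ∈ T, ⨆ i ∈ {i | f i = c}, m i) μ := by
  have hle : ∀ S, ⨆ c ∈ S, ⨆ i ∈ {i | f i = c}, m i ≤ ⨆ i ∈ f ⁻¹' S, m i :=
    fun S => iSup₂_le fun c hc => biSup_mono (by rintro i rfl; exact hc)
  exact indep_of_indep_of_le_left (indep_of_indep_of_le_right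
    (indep_iSup_of_disjoint hm h (hST.preimage f)) (hle T)) (hle S)

theorem iIndepFun_map {ι Ω Ω' : Type*} [MeasurableSpace Ω] [MeasurableSpace Ω'] {β : ι → Type*}
    [∀ i, MeasurableSpace (β i)] {μ : Measure Ω} {Φ : Ω → Ω'} (hΦ : AEMeasurable Φ μ)
    {f : ∀ i, Ω' → β i} (hf : ∀ i, Measurable (f i)) (h : iIndepFun (fun i ω => f i (Φ ω)) μ) :
    iIndepFun f (μ.map Φ) := by
  rw [iIndepFun_iff_measure_inter_preimage_eq_mul] at h ⊢
  intro S s hs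
  rw [Measure.map_apply_of_aemeasurable hΦ (S.measurableSet_biInter fun i hi => hf i (hs i hi)),
    Finset.prod_congr rfl fun i hi => Measure.map_apply_of_aemeasurable hΦ (hf i (hs i hi))]
  simp only [Set.preimage_iInter]
  exact h S hs

end Independence

section ClusterVariables

theorem comap_proj_eq_iSup {ι : Type*} {𝓧 : ι → Type*} [∀ i, MeasurableSpace (𝓧 i)] (A : Set ι) :
    MeasurableSpace.comap (proj 𝓧 A) inferInstance =
      ⨆ i ∈ A, MeasurableSpace.comap (fun x : ∀ i, 𝓧 i => x i) inferInstance := by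
  rw [iSup_subtype']
  exact MeasurableSpace.comap_iSup.trans (iSup_congr fun _ => MeasurableSpace.comap_comp)

variable {V : Type*}

/-- The values at the vertices that make up a family of cluster values. -/
def coord (G : Digraph V) (x : ∀ c : SCC G, Cluster G c → ℝ) (v : V) : ℝ := x (scc G v) ⟨v, rfl⟩

/-- The σ-algebra of the cluster variable of `c`. -/
abbrev clusterSigma (G : Digraph V) (c : SCC G) :
    MeasurableSpace (∀ c : SCC G, Cluster G c → ℝ) :=
  MeasurableSpace.comap (fun x => x c) inferInstance

theorem measurable_coord_clusterSigma (G : Digraph V) (v : V) :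
    Measurable[clusterSigma G (scc G v)] fun x => coord G x v :=
  (measurable_pi_apply _).comp (comap_measurable _)

theorem clusterSigma_le_of_measurable_coord {G : Digraph V} {c : SCC G}
    {m : MeasurableSpace (∀ c : SCC G, Cluster G c → ℝ)}
    (h : ∀ v, scc G v = c → Measurable[m] fun x => coord G x v) : clusterSigma G c ≤ m := by
  refine (measurable_pi_lambda _ ?_).comap_le
  rintro ⟨v, rfl⟩
  exact h v rfl

end ClusterVariables

section Linear

variable {V Ω : Type*} [Fintype V] [DecidableEq V]

theorem isUnit_det_toSquareBlock_scc {B : Matrix V V ℝ} [DecidableEq (SCC (graph B))]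
    (h : IsUnit (1 - B).det) (c : SCC (graph B)) :
    IsUnit ((1 - B).toSquareBlock (scc (graph B)) c).det := by
  let _ : PartialOrder (SCC (graph B)) :=
    { le := fun c d => Reaches (condensation (graph B)) d c
      le_refl := fun _ => .refl
      le_trans := fun _ _ _ h k => k.trans h
      le_antisymm := fun _ _ h k => (isAcyclic_condensation _).reaches_antisymm k h }
  refine isUnit_det_toSquareBlock (fun i j hij => ?_) h c
  by_cases hs : scc (graph B) j = scc (graph B) i
  · exact hs.ge
  · refine Relation.ReflTransGen.single ⟨j, i, ?_, hs, rfl, rfl⟩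
    have hne : i ≠ j := fun e => hs (e ▸ rfl)
    simpa [graph, Matrix.one_apply_ne hne] using hij

/-- The value of the noise at `v`, recovered from the cluster values. -/
def residual (B : Matrix V V ℝ) (v : V) (x : ∀ c : SCC (graph B), Cluster (graph B) c → ℝ) : ℝ :=
  (1 - B).mulVec (coord (graph B) x) v

/-- The σ-algebra of the noise in the component `c`. -/
abbrev noiseSigma (B : Matrix V V ℝ) (c : SCC (graph B)) :
    MeasurableSpace (∀ c : SCC (graph B), Cluster (graph B) c → ℝ) :=
  ⨆ v ∈ {v | scc (graph B) v = c}, MeasurableSpace.comap (residual B v) inferInstance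

theorem measurable_residual (B : Matrix V V ℝ) (v : V) : Measurable (residual B v) :=
  Finset.measurable_fun_sum _ fun u _ =>
    ((measurable_coord_clusterSigma _ u).mono (measurable_pi_apply _).comap_le le_rfl).const_mul _

theorem clusterSigma_le_sup {B : Matrix V V ℝ} (h : IsUnit (1 - B).det) (c : SCC (graph B)) :
    clusterSigma (graph B) c ≤ noiseSigma B c ⊔
      ⨆ d ∈ {d | (condensation (graph B)).Adj d c}, clusterSigma (graph B) d := by
  classical
  refine clusterSigma_le_of_measurable_coord fun v hv => measurable_of_measurable_mulVec
    (isUnit_det_toSquareBlock_scc h c) (fun w hw => ?_) (fun w u hw hu hwu => ?_) hv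
  · exact (comap_measurable (residual B w)).mono
      (le_sup_of_le_left (le_iSup₂_of_le w hw le_rfl)) le_rfl
  · have hne : w ≠ u := fun e => hu (e ▸ hw)
    have hadj : (graph B).Adj u w := by simpa [graph, Matrix.one_apply_ne hne] using hwu
    exact (measurable_coord_clusterSigma _ u).mono (le_sup_of_le_right
      (le_iSup₂_of_le _ ⟨u, w, hadj, fun e => hu (e.trans hw), rfl, hw⟩ le_rfl)) le_rfl

variable [MeasurableSpace Ω] {μ : Measure Ω} {B : Matrix V V ℝ} {ε X : V → Ω → ℝ}

theorem IsLinearSCM.ae_mulVec_eq (hX : IsLinearSCM μ B ε X) :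
    ∀ᵐ ω ∂μ, (1 - B).mulVec (fun v => X v ω) = fun v => ε v ω := by
  filter_upwards [hX.structural_eq] with ω h
  ext v
  rw [Matrix.sub_mulVec, Matrix.one_mulVec, Pi.sub_apply, h v]
  exact add_sub_cancel_left _ _

theorem IsLinearSCM.aemeasurable (hX : IsLinearSCM μ B ε X) (v : V) : AEMeasurable (X v) μ := by
  refine ⟨fun ω => (1 - B)⁻¹.mulVec (fun v => ε v ω) v, ?_, ?_⟩
  · exact Finset.measurable_fun_sum _ fun u _ => (hX.measurable_noise u).const_mul _
  · filter_upwards [hX.ae_mulVec_eq] with ω h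
    rw [← h, Matrix.mulVec_mulVec, Matrix.nonsing_inv_mul _ hX.det_ne_zero.isUnit,
      Matrix.one_mulVec]

theorem IsLinearSCM.iIndepFun_residual (hX : IsLinearSCM μ B ε X) :
    iIndepFun (residual B) (clusterLaw μ (graph B) X) := by
  have hΦ : AEMeasurable (fun ω (c : SCC (graph B)) (v : Cluster (graph B) c) => X v ω) μ :=
    aemeasurable_pi_lambda _ fun c => aemeasurable_pi_lambda _ fun v => hX.aemeasurable v
  refine iIndepFun_map hΦ (measurable_residual B) ((iIndepFun_congr fun v => ?_).1 hX.indep_noise)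
  filter_upwards [hX.ae_mulVec_eq] with ω h
  exact (congrFun h v).symm

theorem IsLinearSCM.isRecursiveSystem (hX : IsLinearSCM μ B ε X) :
    IsRecursiveSystem (condensation (graph B)) (clusterSigma (graph B)) (noiseSigma B)
      (clusterLaw μ (graph B) X) where
  isAcyclic := isAcyclic_condensation _
  noise_le _ := iSup₂_le fun v _ => (measurable_residual B v).comap_le
  indep_noise _ _ := indep_iSup_fiber (fun v => (measurable_residual B v).comap_le)
    hX.iIndepFun_residual.iIndep (scc (graph B))
  le_noise_sup := clusterSigma_le_sup hX.det_ne_zero.isUnit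

theorem IsLinearSCM.isMarkov [IsFiniteMeasure μ] (hX : IsLinearSCM μ B ε X) :
    IsMarkov (condensation (graph B)) (clusterLaw μ (graph B) X) := by
  intro S T Z _ _ _ hsep
  rw [condIndepFun_iff_condIndep]
  convert hX.isRecursiveSystem.condIndep_of_dSep hsep using 1 <;> exact comap_proj_eq_iSup _

end Linear

end CyclicSCM

theorem lemma1 {V Ω : Type*} [Fintype V] [DecidableEq V] [MeasurableSpace Ω]
    (μ : MeasureTheory.Measure Ω) [MeasureTheory.IsProbabilityMeasure μ]
    (B : Matrix V V ℝ) (ε X : V → Ω → ℝ) (hX : CyclicSCM.IsLinearSCM μ B ε X) :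
    CyclicSCM.IsAcyclic (CyclicSCM.condensation (CyclicSCM.graph B)) ∧
      CyclicSCM.IsMarkov (CyclicSCM.condensation (CyclicSCM.graph B))
        (CyclicSCM.clusterLaw μ (CyclicSCM.graph B) X) :=
  ⟨CyclicSCM.isAcyclic_condensation _, hX.isMarkov⟩
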